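/- All functions, forms and maps are smooth ($C^\infty$). A *Monge structure* on an open set $M\subset\mathbb R^8$ is a coframe $(\eta^1,\dots,\eta^8)$ on $M$, considered modulo replacements $\eta^i\mapsto a^i{}_j\eta^j$ with nonsingular matrix functions $(a^i{}_j)$ satisfying $a^i{}_j=0$ for $i\le 5<j$. Two such structures, $(\eta^i)$ on $M$ and $(\bar\eta^i)$ on $\bar M$, are *locally equivalent* near $p\in M$ if there is a diffeomorphism $\phi$ from a neighbourhood of $p$ onto an open subset of $\bar M$ with $\phi^*\bar\eta^i=a^i{}_j\eta^j$ for some $(a^i{}_j)$ of this kind. A system of ODEs $\dot z_{11}=f_{11}(\dot x_1,\dot x_2)$, $\dot z_{12}=f_{12}(\dot x_1,\dot x_2)$, $\dot z_{22}=f_{22}(\dot x_1,\dot x_2)$ (a *Monge system*) defines a Monge structure on the space with coordinates $(t,x_1,x_2,\dot x_1,\dot x_2,z_{11},z_{12},z_{22})$, with the coframe $$dz_{12}-f_{12}dt,\ dz_{11}-f_{11}dt,\ dz_{22}-f_{22}dt,\ dx_2-\dot x_2dt,\ dx_1-\dot x_1dt,\ d\dot x_2,\ d\dot x_1,\ dt.$$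 A coframe $(\omega^1,\dots,\omega^8)$ of a Monge structure, defined on an open set $W$, is called *adapted* if $$d\omega^1=-\omega^4\wedge\omega^7-\omega^5\wedge\omega^6,\quad d\omega^2=-2\,\omega^5\wedge\omega^7,\quad d\omega^3=u\,\omega^2\wedge\omega^7-2\,\omega^4\wedge\omega^6,$$ $$d\omega^4=\omega^6\wedge\omega^8,\quad d\omega^5=\omega^7\wedge\omega^8,\quad d\omega^6=d\omega^7=d\omega^8=0$$ with a function $u$ that vanishes nowhere on $W$. For an adapted coframe write $\partial_k g$ for the coefficients in $dg=\sum_k(\partial_k g)\,\omega^k$, and put $v_1=\partial_2u$, $v_2=\partial_7u$, $w_3=\partial_7v_2$, $z_4=\partial_7w_3$, $$I_1=5v_2^2-4uw_3,\qquad I_2=v_1,\qquad S_4=\frac{9I_1v_2-15v_2^3+8u^2z_4}{2\sqrt{\epsilon I_1^3}},\qquad \epsilon=\mathrm{sign}(I_1).$$ **Proposition.** (1) Let a Monge structure (for instance that of a Monge system) have an adapted coframe on an open set $W$ with $I_1\neq0$ everywhere on $W$ and $I_2=0$ identically on $W$. Then near each point of $W$ the structure is locally equivalent, by some $\phi$,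 to that of the Monge system $$\dot z_{11}=\dot x_1^2,\qquad \dot z_{12}=\dot x_1\dot x_2,\qquad \dot z_{22}=\dot x_2^2+h(\dot x_1),\qquad \dot x_1\in J,\tag{$*$}$$ for some function $h$ on an open set $J\subset\mathbb R$ with $h'''\neq0$ and $5h''''^2-4h'''h^{(5)}\neq0$ on $J$. Moreover $\phi$ and $h$ can be chosen so that on the domain of $\phi$ $$I_1=\tfrac14\big(5h''''^2-4h'''h^{(5)}\big)\neq0,\qquad S_4=\frac{15h''''^3-18h'''h''''h^{(5)}+4h'''^2h^{(6)}}{\sqrt{\epsilon\,(5h''''^2-4h'''h^{(5)})^3}},\tag{$**$}$$ where the derivatives of $h$ are taken at $\dot x_1\circ\phi$ and $\epsilon$ is the sign of $5h''''^2-4h'''h^{(5)}$, which is the sign of $I_1$. (2) Conversely, for every open $J\subset\mathbb R$ and every function $h$ on $J$ with $h'''\neq0$ on $J$, the Monge structure of $(*)$ has an adapted coframe, defined on its whole space, for which $u=\tfrac12h'''$, $I_2=0$ and $I_1=\tfrac14(5h''''^2-4h'''h^{(5)})$, and for which $S_4$ is given by the formula in $(**)$ at all points where $I_1\neq0$ (derivatives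 of $h$ at $\dot x_1$). -/

import Mathlib

namespace MongeGeom

/-- The model space of an 8-dimensional manifold (everything here is local). -/
abbrev E8 : Type := Fin 8 → ℝ

/-- Differential 1-forms on `ℝ⁸`. -/
abbrev OneForm : Type := E8 → (E8 →L[ℝ] ℝ)

/-- Eight 1-forms. The form usually written `ω^i`, `i = 1, …, 8`, is `ω (i - 1)`. -/
abbrev Forms8 : Type := Fin 8 → OneForm

/-- A 1-form as an alternating form of degree one in the sense of Mathlib. -/
noncomputable def OneForm.toAlt (α : OneForm) : E8 → E8 [⋀^Fin 1]→L[ℝ] ℝ :=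
  fun p => ContinuousAlternatingMap.ofSubsingleton ℝ E8 ℝ (0 : Fin 1) (α p)

/-- The exterior derivative of a 1-form. -/
noncomputable def OneForm.d (α : OneForm) : E8 → E8 [⋀^Fin 2]→L[ℝ] ℝ :=
  extDeriv α.toAlt

/-- The wedge product of two 1-forms, `(α ∧ β)(v, w) = α v * β w - α w * β v`. -/
noncomputable def OneForm.wedge (α β : OneForm) : E8 → E8 [⋀^Fin 2]→L[ℝ] ℝ :=
  fun p => ContinuousAlternatingMap.alternatizeUncurryFin ((α p).smulRight (β.toAlt p))

theorem OneForm.wedge_apply (α β : OneForm) (p v w : E8) :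
    α.wedge β p ![v, w] = α p v * β p w - α p w * β p v := by
  simp [OneForm.wedge, OneForm.toAlt, ContinuousAlternatingMap.alternatizeUncurryFin_apply,
    Fin.sum_univ_two, Fin.removeNth, sub_eq_add_neg]

theorem OneForm.d_apply {α : OneForm} {p : E8} (hα : DifferentiableAt ℝ α p) (v w : E8) :
    α.d p ![v, w] = fderiv ℝ α p v w - fderiv ℝ α p w v := by
  let L : (E8 →L[ℝ] ℝ) →L[ℝ] (E8 [⋀^Fin 1]→L[ℝ] ℝ) :=
    ((ContinuousAlternatingMap.ofSubsingletonLIE (𝕜 := ℝ) (E := E8) (F := ℝ)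
      (0 : Fin 1)).toContinuousLinearEquiv : (E8 →L[ℝ] ℝ) →L[ℝ] E8 [⋀^Fin 1]→L[ℝ] ℝ)
  have h : fderiv ℝ α.toAlt p = L.comp (fderiv ℝ α p) :=
    (L.hasFDerivAt.comp p hα.hasFDerivAt).fderiv
  have hL : ∀ (β : E8 →L[ℝ] ℝ) (x : Fin 1 → E8), L β x = β (x 0) := fun _ _ => rfl
  simp [OneForm.d, extDeriv, h, hL, ContinuousAlternatingMap.alternatizeUncurryFin_apply,
    Fin.sum_univ_two, Fin.removeNth, sub_eq_add_neg]

/-- The pullback of a 1-form by a map. -/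
noncomputable def OneForm.pullback (φ : E8 → E8) (α : OneForm) : OneForm :=
  fun p => (α (φ p)).comp (fderiv ℝ φ p)

/-- The differential `dy_k` of the `k`-th coordinate function of `ℝ⁸`. -/
noncomputable def dcoord (k : Fin 8) : E8 →L[ℝ] ℝ := ContinuousLinearMap.proj k

/-- `ω` is a smooth coframe on the set `U`. -/
def IsCoframeOn (U : Set E8) (ω : Forms8) : Prop :=
  (∀ i, ContDiffOn ℝ (⊤ : ℕ∞) (ω i) U) ∧ ∀ p ∈ U, LinearIndependent ℝ (fun i => ω i p)

/-- `ω^i = a^i_j η^j` on `U` for a smooth nonsingular matrix function `a` whose entries `a^i_j`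
with `i ≤ 5 < j` vanish: the freedom in the choice of a coframe of a Monge structure. -/
def MongeRelatedOn (U : Set E8) (η ω : Forms8) : Prop :=
  ∃ a : E8 → Matrix (Fin 8) (Fin 8) ℝ,
    (∀ i j, ContDiffOn ℝ (⊤ : ℕ∞) (fun p => a p i j) U) ∧
    ∀ p ∈ U, (a p).det ≠ 0 ∧
      (∀ i j : Fin 8, (i : ℕ) < 5 → 5 ≤ (j : ℕ) → a p i j = 0) ∧
      ∀ i, ω i p = ∑ j, a p i j • η j p

/-- A Monge structure on an open subset of `ℝ⁸`, given by one of its coframes; the structure is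
the class of this coframe modulo `MongeRelatedOn`. -/
structure MongeStructure where
  carrier : Set E8
  isOpen_carrier : IsOpen carrier
  coframe : Forms8
  isCoframe : IsCoframeOn carrier coframe

/-- `φ` is a local equivalence from the Monge structure `S` to the Monge structure `S'`: a
diffeomorphism between open subsets with `φ^* η'^i = a^i_j η^j`, where `a` is as in
`MongeRelatedOn`. -/
structure IsLocalEquivalence (S S' : MongeStructure) (φ : OpenPartialHomeomorph E8 E8) :
    Prop where
  source_subset : φ.source ⊆ S.carrier
  target_subset : φ.target ⊆ S'.carrier
  smooth : ContDiffOn ℝ (⊤ : ℕ∞) φ φ.source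
  smooth_symm : ContDiffOn ℝ (⊤ : ℕ∞) φ.symm φ.target
  related : MongeRelatedOn φ.source S.coframe (fun i => (S'.coframe i).pullback φ)

/-- The system of ODEs `ż₁₁ = f₁₁(ẋ₁, ẋ₂)`, `ż₁₂ = f₁₂(ẋ₁, ẋ₂)`, `ż₂₂ = f₂₂(ẋ₁, ẋ₂)` with smooth
right-hand sides on an open set `dom` of pairs `(ẋ₁, ẋ₂)`. -/
structure MongeSystem where
  dom : Set (ℝ × ℝ)
  isOpen_dom : IsOpen dom
  f₁₁ : ℝ × ℝ → ℝ
  f₁₂ : ℝ × ℝ → ℝ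
  f₂₂ : ℝ × ℝ → ℝ
  smooth₁₁ : ContDiffOn ℝ (⊤ : ℕ∞) f₁₁ dom
  smooth₁₂ : ContDiffOn ℝ (⊤ : ℕ∞) f₁₂ dom
  smooth₂₂ : ContDiffOn ℝ (⊤ : ℕ∞) f₂₂ dom

namespace MongeSystem

/-- The coordinate functions of `ℝ⁸` are `(t, x₁, x₂, ẋ₁, ẋ₂, z₁₁, z₁₂, z₂₂)`, in this order. -/
def space (F : MongeSystem) : Set E8 := {p | (p 3, p 4) ∈ F.dom}

/-- The canonical coframe of a Monge system. Its first five forms are the Pfaffian system of the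
ODEs, i.e. they annihilate the distribution spanned by
`∂_t + f₁₁ ∂_z₁₁ + f₁₂ ∂_z₁₂ + f₂₂ ∂_z₂₂ + ẋ₁ ∂_x₁ + ẋ₂ ∂_x₂`, `∂_ẋ₁` and `∂_ẋ₂`. -/
noncomputable def coframe (F : MongeSystem) : Forms8 :=
  ![fun p => dcoord 6 - F.f₁₂ (p 3, p 4) • dcoord 0,
    fun p => dcoord 5 - F.f₁₁ (p 3, p 4) • dcoord 0,
    fun p => dcoord 7 - F.f₂₂ (p 3, p 4) • dcoord 0,
    fun p => dcoord 2 - p 4 • dcoord 0,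
    fun p => dcoord 1 - p 3 • dcoord 0,
    fun _ => dcoord 4,
    fun _ => dcoord 3,
    fun _ => dcoord 0]

theorem isOpen_space (F : MongeSystem) : IsOpen F.space :=
  F.isOpen_dom.preimage (by fun_prop : Continuous fun p : E8 => (p 3, p 4))

theorem isCoframeOn_coframe (F : MongeSystem) : IsCoframeOn F.space F.coframe := by
  have hpair : ContDiffOn ℝ (⊤ : ℕ∞) (fun p : E8 => (p 3, p 4)) F.space := by fun_prop
  have hm : Set.MapsTo (fun p : E8 => (p 3, p 4)) F.space F.dom := fun p hp => hp
  have h11 := F.smooth₁₁.comp hpair hm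
  have h12 := F.smooth₁₂.comp hpair hm
  have h22 := F.smooth₂₂.comp hpair hm
  refine ⟨?_, ?_⟩
  · intro i
    fin_cases i
    · exact contDiffOn_const.sub (h12.smul contDiffOn_const)
    · exact contDiffOn_const.sub (h11.smul contDiffOn_const)
    · exact contDiffOn_const.sub (h22.smul contDiffOn_const)
    · exact contDiffOn_const.sub ((contDiff_apply ℝ ℝ (4 : Fin 8)).contDiffOn.smul contDiffOn_const)
    · exact contDiffOn_const.sub ((contDiff_apply ℝ ℝ (3 : Fin 8)).contDiffOn.smul contDiffOn_const)
    · exact contDiffOn_const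
    · exact contDiffOn_const
    · exact contDiffOn_const
  · intro p _
    rw [Fintype.linearIndependent_iff]
    intro g hg
    have key : ∀ k : Fin 8, (∑ i, g i • F.coframe i p) (Pi.single k 1) = 0 := by
      intro k; rw [hg]; rfl
    have k0 := key 0
    have k1 := key 1
    have k2 := key 2
    have k3 := key 3
    have k4 := key 4
    have k5 := key 5
    have k6 := key 6
    have k7 := key 7
    simp [Fin.sum_univ_eight, coframe, dcoord] at k0 k1 k2 k3 k4 k5 k6 k7
    intro i
    fin_cases i <;> simp_all

/-- The Monge structure of a Monge system. -/
noncomputable def toStructure (F : MongeSystem) : MongeStructure where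
  carrier := F.space
  isOpen_carrier := F.isOpen_space
  coframe := F.coframe
  isCoframe := F.isCoframeOn_coframe

/-- The system `ż₁₁ = ẋ₁²`, `ż₁₂ = ẋ₁ ẋ₂`, `ż₂₂ = ẋ₂² + h(ẋ₁)`, where `ẋ₁ ∈ J`. -/
noncomputable def ofFun (h : ℝ → ℝ) (J : Set ℝ) (hJ : IsOpen J) (hh : ContDiffOn ℝ (⊤ : ℕ∞) h J) :
    MongeSystem where
  dom := {x | x.1 ∈ J}
  isOpen_dom := hJ.preimage continuous_fst
  f₁₁ := fun x => x.1 ^ 2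
  f₁₂ := fun x => x.1 * x.2
  f₂₂ := fun x => x.2 ^ 2 + h x.1
  smooth₁₁ := by fun_prop
  smooth₁₂ := by fun_prop
  smooth₂₂ := ContDiffOn.add (by fun_prop) (hh.comp contDiffOn_fst fun _ hx => hx)

end MongeSystem

/-- The smooth coframe `ω` on `W` satisfies
`dω¹ = -ω⁴∧ω⁷ - ω⁵∧ω⁶`, `dω² = -2 ω⁵∧ω⁷`, `dω³ = u ω²∧ω⁷ - 2 ω⁴∧ω⁶`, `dω⁴ = ω⁶∧ω⁸`,
`dω⁵ = ω⁷∧ω⁸`, `dω⁶ = dω⁷ = dω⁸ = 0` with a smooth nowhere vanishing function `u`. -/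
structure SatisfiesEDS (W : Set E8) (ω : Forms8) (u : E8 → ℝ) : Prop where
  isOpen : IsOpen W
  isCoframe : IsCoframeOn W ω
  smooth_u : ContDiffOn ℝ (⊤ : ℕ∞) u W
  u_ne_zero : ∀ p ∈ W, u p ≠ 0
  d1 : ∀ p ∈ W, (ω 0).d p = -(ω 3).wedge (ω 6) p - (ω 4).wedge (ω 5) p
  d2 : ∀ p ∈ W, (ω 1).d p = -(2 : ℝ) • (ω 4).wedge (ω 6) p
  d3 : ∀ p ∈ W, (ω 2).d p = u p • (ω 1).wedge (ω 6) p - (2 : ℝ) • (ω 3).wedge (ω 5) p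
  d4 : ∀ p ∈ W, (ω 3).d p = (ω 5).wedge (ω 7) p
  d5 : ∀ p ∈ W, (ω 4).d p = (ω 6).wedge (ω 7) p
  d6 : ∀ p ∈ W, (ω 5).d p = 0
  d7 : ∀ p ∈ W, (ω 6).d p = 0
  d8 : ∀ p ∈ W, (ω 7).d p = 0

/-- `ω` is an adapted coframe of the Monge structure `S` on the open set `W`: it is one of the
coframes of `S` there, and it satisfies the exterior differential system above. -/
structure MongeStructure.IsAdapted (S : MongeStructure) (W : Set E8) (ω : Forms8) (u : E8 → ℝ) :
    Prop where
  subset : W ⊆ S.carrier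
  related : MongeRelatedOn W S.coframe ω
  eds : SatisfiesEDS W ω u

/-- The vector field `E_k` of the frame dual to the coframe `ω`. -/
noncomputable def dualFrame (ω : Forms8) (k : Fin 8) (p : E8) : E8 :=
  fun j => ((Matrix.of fun i l : Fin 8 => ω i p (Pi.single l 1))⁻¹ : Matrix (Fin 8) (Fin 8) ℝ) j k

/-- The coefficient at `ω^(k+1)` of the differential `dg`, written in the coframe `ω`. -/
noncomputable def coeffD (ω : Forms8) (k : Fin 8) (g : E8 → ℝ) : E8 → ℝ :=
  fun p => fderiv ℝ g p (dualFrame ω k p)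

/-! The structure functions of an adapted coframe: `du = v₁ ω² + v₂ ω⁷`, the coefficient `w₃` of
`dv₂` at `ω⁷`, and the coefficient `z₄` of `dw₃` at `ω⁷`. -/

noncomputable def v₁ (ω : Forms8) (u : E8 → ℝ) : E8 → ℝ := coeffD ω 1 u

noncomputable def v₂ (ω : Forms8) (u : E8 → ℝ) : E8 → ℝ := coeffD ω 6 u

noncomputable def w₃ (ω : Forms8) (u : E8 → ℝ) : E8 → ℝ := coeffD ω 6 (v₂ ω u)

noncomputable def z₄ (ω : Forms8) (u : E8 → ℝ) : E8 → ℝ := coeffD ω 6 (w₃ ω u)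

/-- The basic invariant `I₁ = 5 v₂² - 4 u w₃`. -/
noncomputable def I₁ (ω : Forms8) (u : E8 → ℝ) (p : E8) : ℝ :=
  5 * v₂ ω u p ^ 2 - 4 * u p * w₃ ω u p

/-- The basic invariant `I₂ = v₁`. -/
noncomputable def I₂ (ω : Forms8) (u : E8 → ℝ) (p : E8) : ℝ := v₁ ω u p

/-- The invariant `S₄ = (9 I₁ v₂ - 15 v₂³ + 8 u² z₄) / (2 √(ε I₁³))`, `ε = sign I₁`. -/
noncomputable def S₄ (ω : Forms8) (u : E8 → ℝ) (p : E8) : ℝ :=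
  (9 * I₁ ω u p * v₂ ω u p - 15 * v₂ ω u p ^ 3 + 8 * u p ^ 2 * z₄ ω u p) /
    (2 * Real.sqrt (Real.sign (I₁ ω u p) * I₁ ω u p ^ 3))

/-- `5 h''''² - 4 h''' h⁽⁵⁾`. -/
noncomputable def discr (h : ℝ → ℝ) (x : ℝ) : ℝ :=
  5 * iteratedDeriv 4 h x ^ 2 - 4 * iteratedDeriv 3 h x * iteratedDeriv 5 h x

/-- `(15 h''''³ - 18 h''' h'''' h⁽⁵⁾ + 4 h'''² h⁽⁶⁾) / √(ε (5 h''''² - 4 h''' h⁽⁵⁾)³)`, where `ε` is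
the sign of `5 h''''² - 4 h''' h⁽⁵⁾`. -/
noncomputable def s4Formula (h : ℝ → ℝ) (x : ℝ) : ℝ :=
  (15 * iteratedDeriv 4 h x ^ 3
      - 18 * iteratedDeriv 3 h x * iteratedDeriv 4 h x * iteratedDeriv 5 h x
      + 4 * iteratedDeriv 3 h x ^ 2 * iteratedDeriv 6 h x) /
    Real.sqrt (Real.sign (discr h x) * discr h x ^ 3)

end MongeGeom

open MongeGeom

/-! The structure equations are integrated one form at a time (the form ω^i is `ω (i-1)`). As ω⁸,
ω⁷, ω⁶ are closed, locally -ω⁸ = dt, ω⁷ = dy₁, ω⁶ = dy₂, where y₁, y₂ will be the coordinates ẋ₁,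
ẋ₂. Suitable combinations of the remaining forms, with coefficients polynomial in y₁, y₂, are then
closed, and their primitives are x₁, x₂, z₁₁, z₁₂.

Only dω³ involves u. Expanding d(dω³) = 0 gives du ∧ ω² ∧ ω⁷ = 0 (`SatisfiesEDS.du_wedge_eq_zero`),
so du = v₁ω² + v₂ω⁷. With I₂ = v₁ = 0 this says du = v₂ dy₁, hence locally u = U(y₁)
(`exists_eq_comp_of_fderiv_eq_smul`). Choosing h with h''' = 2U makes a last combination closed,
with primitive z₂₂. The eight primitives form a chart φ, and the pulled-back Monge coframe of the
normal form is an explicit combination of the ω^i of the admissible kind.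

For a prescribed h, solving the same relations for ω gives `modelCoframe` and the converse. In both
directions ∂₇ acts on functions of y₁ as d/dy₁, so u, v₂, w₃, z₄ are the halves of h''', …, h⁽⁶⁾,
and the formulas for I₁ and S₄ are algebra (`invariants_of_comp`). -/

namespace MongeGeom

open Set Filter Topology

/-! ### Primitives, charts and functional dependence -/

section Calculus

variable {E : Type*} [NormedAddCommGroup E] [NormedSpace ℝ E]

/-- Poincaré lemma on a convex set. Smoothness of the primitive is automatic, since its derivative
is the smooth form α. Closedness is stated as symmetry of the derivative. -/
theorem exists_smooth_primitive_of_closed {B : Set E} (hB : Convex ℝ B) (hBo : IsOpen B)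
    {α : E → E →L[ℝ] ℝ} (hα : ContDiffOn ℝ (⊤ : ℕ∞) α B)
    (hd : ∀ q ∈ B, ∃ α' : E →L[ℝ] E →L[ℝ] ℝ, HasFDerivAt α α' q ∧ ∀ v w, α' v w = α' w v) :
    ∃ f : E → ℝ, ContDiffOn ℝ (⊤ : ℕ∞) f B ∧ ∀ q ∈ B, HasFDerivAt f (α q) q := by
  obtain ⟨f, hf⟩ := hB.exists_forall_hasFDerivAt_of_fderiv_symmetric hBo
    (hα.differentiableOn (by simp)) fun q hq => by
      obtain ⟨α', h, hs⟩ := hd q hq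
      rw [h.fderiv]
      exact hs
  refine ⟨f, (contDiffOn_infty_iff_fderiv_of_isOpen hBo).2
    ⟨fun q hq => (hf q hq).differentiableAt.differentiableWithinAt, ?_⟩, hf⟩
  exact hα.congr fun q hq => (hf q hq).fderiv

theorem exists_smooth_chart [CompleteSpace E] {O : Set E} (hO : IsOpen O) {f : E → E}
    (hf : ContDiffOn ℝ (⊤ : ℕ∞) f O) {p : E} (hp : p ∈ O) {e : E ≃L[ℝ] E}
    (he : HasFDerivAt f (e : E →L[ℝ] E) p) :
    ∃ φ : OpenPartialHomeomorph E E, (φ : E → E) = f ∧ p ∈ φ.source ∧ φ.source ⊆ O ∧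
      ContDiffOn ℝ (⊤ : ℕ∞) φ.symm φ.target := by
  have hfp : ContDiffAt ℝ (⊤ : ℕ∞) f p := hf.contDiffAt (hO.mem_nhds hp)
  have hn : ((⊤ : ℕ∞) : WithTop ℕ∞) ≠ 0 := by simp
  set ψ := hfp.toOpenPartialHomeomorph f he hn with hψ
  have hcont : ContinuousOn (fderiv ℝ f) O :=
    ((contDiffOn_infty_iff_fderiv_of_isOpen hO).1 hf).2.continuousOn
  -- Restricting to the open set where the derivative is invertible makes the inverse smooth on the
  -- whole target, not only at the image of p.
  let V : Set E := O ∩ fderiv ℝ f ⁻¹' range ((↑) : (E ≃L[ℝ] E) → E →L[ℝ] E)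
  have hV : IsOpen V := hcont.isOpen_inter_preimage hO ContinuousLinearEquiv.isOpen
  have hpV : p ∈ V := ⟨hp, e, he.fderiv.symm⟩
  refine ⟨ψ.restrOpen V hV, rfl, ⟨hfp.mem_toOpenPartialHomeomorph_source he hn, hpV⟩,
    fun q hq => hq.2.1, ?_⟩
  intro y hy
  have hs : (ψ.restrOpen V hV).symm y ∈ (ψ.restrOpen V hV).source :=
    (ψ.restrOpen V hV).map_target hy
  obtain ⟨e', he'⟩ := hs.2.2
  have hd := hf.contDiffAt (hO.mem_nhds hs.2.1)
  refine ((ψ.restrOpen V hV).contDiffAt_symm hy (f₀' := e') ?_ hd).contDiffWithinAt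
  rw [he']
  exact (hd.differentiableAt hn).hasFDerivAt

/-- If `du` is a multiple of `dy ≠ 0`, then `u` is locally a function of `y`. -/
theorem exists_eq_comp_of_fderiv_eq_smul [CompleteSpace E] {O : Set E} (hO : IsOpen O)
    {y u c : E → ℝ} (hy : ContDiffOn ℝ (⊤ : ℕ∞) y O) (hu : ContDiffOn ℝ (⊤ : ℕ∞) u O)
    (hd : ∀ q ∈ O, fderiv ℝ u q = c q • fderiv ℝ y q) {p : E} (hp : p ∈ O)
    (hne : fderiv ℝ y p ≠ 0) :
    ∃ (U : ℝ → ℝ) (r : ℝ) (V : Set E), 0 < r ∧ ContDiffOn ℝ (⊤ : ℕ∞) U (Metric.ball (y p) r) ∧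
      IsOpen V ∧ p ∈ V ∧ V ⊆ O ∧ ∀ q ∈ V, y q ∈ Metric.ball (y p) r ∧ u q = U (y q) := by
  obtain ⟨e₀, he₀⟩ : ∃ e₀, fderiv ℝ y p e₀ ≠ 0 := by
    by_contra! h
    exact hne (by ext v; simpa using h v)
  set L := fderiv ℝ y p with hL
  set e : E := (L e₀)⁻¹ • e₀ with hedef
  have he : L e = 1 := by simp [hedef, he₀]
  have hn : ((⊤ : ℕ∞) : WithTop ℕ∞) ≠ 0 := by simp
  -- This map straightens y: since L e = 1, L ∘ f = y, while its derivative at p is the identity.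
  let f : E → E := fun q => q + (y q - L q) • e
  have hf : ContDiffOn ℝ (⊤ : ℕ∞) f O :=
    contDiffOn_id.add ((hy.sub L.contDiff.contDiffOn).smul contDiffOn_const)
  have hyd : ∀ q ∈ O, HasFDerivAt y (fderiv ℝ y q) q := fun q hq =>
    ((hy.contDiffAt (hO.mem_nhds hq)).differentiableAt hn).hasFDerivAt
  have hud : ∀ q ∈ O, HasFDerivAt u (c q • fderiv ℝ y q) q := fun q hq => by
    rw [← hd q hq]
    exact ((hu.contDiffAt (hO.mem_nhds hq)).differentiableAt hn).hasFDerivAt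
  have hfp : HasFDerivAt f ((ContinuousLinearEquiv.refl ℝ E : E ≃L[ℝ] E) : E →L[ℝ] E) p := by
    have := (hasFDerivAt_id p).add (((hyd p hp).sub L.hasFDerivAt).smul_const e)
    convert! this using 1
    ext v
    simp [hL]
  have hLf : ∀ q, L (f q) = y q := fun q => by simp [f, he]
  obtain ⟨φ, hφ, hpφ, hφO, hsymm⟩ := exists_smooth_chart hO hf hp hfp
  have hinv : ∀ a ∈ φ.target, f (φ.symm a) = a := fun a ha => by
    rw [← hφ]; exact φ.right_inv ha
  have hyL : ∀ a ∈ φ.target, y (φ.symm a) = L a := fun a ha => by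
    rw [← hLf, hinv a ha]
  have hfpt : f p ∈ φ.target := by rw [← hφ]; exact φ.map_source hpφ
  obtain ⟨δ, hδ, hball⟩ := Metric.isOpen_iff.1 φ.open_target _ hfpt
  let g : E → ℝ := fun a => u (φ.symm a)
  have hgd : ∀ a ∈ φ.target, HasFDerivAt g (c (φ.symm a) • L) a := by
    intro a ha
    have hs : HasFDerivAt φ.symm (fderiv ℝ φ.symm a) a :=
      ((hsymm.contDiffAt (φ.open_target.mem_nhds ha)).differentiableAt hn).hasFDerivAt
    have hO' := hφO (φ.map_target ha)
    have h1 := (hyd _ hO').comp a hs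
    have h2 := (hud _ hO').comp a hs
    have h3 : HasFDerivAt (y ∘ φ.symm) L a :=
      L.hasFDerivAt.congr_of_eventuallyEq
        (Filter.eventually_of_mem (φ.open_target.mem_nhds ha) hyL)
    rw [← h1.unique h3]
    exact h2
  have hgc : ContDiffOn ℝ (⊤ : ℕ∞) g φ.target :=
    hu.comp hsymm fun a ha => hφO (φ.map_target ha)
  -- Chosen so that the segment through f p in direction e, with parameter within r, stays in the
  -- δ-ball.
  set r := δ / (‖e‖ + 1) with hr
  have hr0 : 0 < r := by positivity
  have hline : ∀ s ∈ Metric.ball (y p) r, f p + (s - y p) • e ∈ Metric.ball (f p) δ := by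
    intro s hs
    rw [Metric.mem_ball, Real.dist_eq] at hs
    rw [Metric.mem_ball, dist_eq_norm, add_sub_cancel_left, norm_smul, Real.norm_eq_abs]
    calc |s - y p| * ‖e‖ ≤ |s - y p| * (‖e‖ + 1) := by gcongr; linarith
      _ < r * (‖e‖ + 1) := by gcongr
      _ = δ := by rw [hr]; field_simp
  -- In the chart dg is a multiple of L, so g is constant along a segment on which L is constant;
  -- the ball is convex and contains the segment.
  have hconst : ∀ a ∈ Metric.ball (f p) δ, ∀ b ∈ Metric.ball (f p) δ, L a = L b → g a = g b := by
    intro a ha b hb hab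
    let l : ℝ → E := fun t => a + t • (b - a)
    have hl : ∀ t ∈ Icc (0 : ℝ) 1, l t ∈ Metric.ball (f p) δ := fun t ht =>
      (convex_ball (f p) δ).add_smul_sub_mem ha hb ht
    have hder : ∀ t ∈ Icc (0 : ℝ) 1, HasDerivAt (g ∘ l) 0 t := by
      intro t ht
      have h1 : HasDerivAt l (b - a) t := by
        have := ((hasDerivAt_id t).smul_const (b - a)).const_add a
        rwa [one_smul] at this
      have := (hgd _ (hball (hl t ht))).comp_hasDerivAt t h1
      simpa [hab] using this
    have := constant_of_derivWithin_zero (f := g ∘ l) (a := 0) (b := 1)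
      (fun t ht => (hder t ht).differentiableAt.differentiableWithinAt)
      (fun t ht => ((hder t (Ico_subset_Icc_self ht)).hasDerivWithinAt).derivWithin
        (uniqueDiffOn_Icc one_pos t (Ico_subset_Icc_self ht))) 1 (by simp)
    simpa [l] using this.symm
  refine ⟨fun s => g (f p + (s - y p) • e), r,
    (O ∩ y ⁻¹' Metric.ball (y p) r) ∩ (O ∩ f ⁻¹' Metric.ball (f p) δ) ∩ φ.source, hr0,
    hgc.comp (ContDiff.contDiffOn (by fun_prop)) fun s hs => hball (hline s hs), ?_, ?_, ?_, ?_⟩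
  · exact ((hy.continuousOn.isOpen_inter_preimage hO Metric.isOpen_ball).inter
      (hf.continuousOn.isOpen_inter_preimage hO Metric.isOpen_ball)).inter φ.open_source
  · exact ⟨⟨⟨hp, Metric.mem_ball_self hr0⟩, hp, Metric.mem_ball_self hδ⟩, hpφ⟩
  · exact fun q hq => hq.1.1.1
  · rintro q ⟨⟨⟨hqO, hqy⟩, -, hqf⟩, hqφ⟩
    refine ⟨hqy, ?_⟩
    have h1 : g (f q) = u q := by
      change u (φ.symm (f q)) = u q
      rw [← hφ, φ.left_inv hqφ]
    rw [← h1]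
    refine hconst _ hqf _ (hline _ hqy) ?_
    rw [hLf, map_add, map_smul, he, hLf]
    simp

theorem exists_smooth_antideriv {J : Set ℝ} (hJ : Convex ℝ J) (hJo : IsOpen J) {U : ℝ → ℝ}
    (hU : ContDiffOn ℝ (⊤ : ℕ∞) U J) :
    ∃ h : ℝ → ℝ, ContDiffOn ℝ (⊤ : ℕ∞) h J ∧ EqOn (deriv h) U J := by
  obtain ⟨g, hg⟩ := hJ.exists_forall_hasDerivWithinAt (hU.differentiableOn (by simp))
  have hg' : ∀ x ∈ J, HasDerivAt g (U x) x := fun x hx => (hg x hx).hasDerivAt (hJo.mem_nhds hx)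
  refine ⟨g, (contDiffOn_infty_iff_deriv_of_isOpen hJo).2
    ⟨fun x hx => (hg x hx).differentiableWithinAt, ?_⟩, fun x hx => (hg' x hx).deriv⟩
  exact hU.congr fun x hx => (hg' x hx).deriv

theorem exists_smooth_iteratedDeriv_eq {J : Set ℝ} (hJ : Convex ℝ J) (hJo : IsOpen J) (n : ℕ)
    {U : ℝ → ℝ} (hU : ContDiffOn ℝ (⊤ : ℕ∞) U J) :
    ∃ h : ℝ → ℝ, ContDiffOn ℝ (⊤ : ℕ∞) h J ∧ EqOn (iteratedDeriv n h) U J := by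
  induction n generalizing U with
  | zero => exact ⟨U, hU, by intro x _; simp⟩
  | succ n ih =>
    obtain ⟨g, hg, hg'⟩ := exists_smooth_antideriv hJ hJo hU
    obtain ⟨h, hh, hh'⟩ := ih hg
    refine ⟨h, hh, fun x hx => ?_⟩
    rw [iteratedDeriv_succ, (hh'.eventuallyEq_of_mem (hJo.mem_nhds hx)).deriv_eq]
    exact hg' hx

theorem contDiffOn_iteratedDeriv {J : Set ℝ} (hJ : IsOpen J) {h : ℝ → ℝ}
    (hh : ContDiffOn ℝ (⊤ : ℕ∞) h J) (n : ℕ) : ContDiffOn ℝ (⊤ : ℕ∞) (iteratedDeriv n h) J := by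
  induction n with
  | zero => simpa using hh
  | succ n ih =>
    rw [iteratedDeriv_succ]
    exact ((contDiffOn_infty_iff_deriv_of_isOpen hJ).1 ih).2

theorem hasDerivAt_iteratedDeriv {J : Set ℝ} (hJ : IsOpen J) {h : ℝ → ℝ}
    (hh : ContDiffOn ℝ (⊤ : ℕ∞) h J) (n : ℕ) {x : ℝ} (hx : x ∈ J) :
    HasDerivAt (iteratedDeriv n h) (iteratedDeriv (n + 1) h x) x := by
  rw [iteratedDeriv_succ]
  exact (((contDiffOn_iteratedDeriv hJ hh n).contDiffAt (hJ.mem_nhds hx)).differentiableAt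
    (by simp)).hasDerivAt

theorem isOpen_discr_ne_zero {J : Set ℝ} (hJ : IsOpen J) {h : ℝ → ℝ}
    (hh : ContDiffOn ℝ (⊤ : ℕ∞) h J) : IsOpen {x ∈ J | iteratedDeriv 3 h x ≠ 0 ∧ discr h x ≠ 0} := by
  have h3 := (contDiffOn_iteratedDeriv hJ hh 3).continuousOn
  have h4 := (contDiffOn_iteratedDeriv hJ hh 4).continuousOn
  have h5 := (contDiffOn_iteratedDeriv hJ hh 5).continuousOn
  have hd : ContinuousOn (discr h) J := by
    unfold discr
    fun_prop
  have := (h3.prodMk hd).isOpen_inter_preimage hJ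
    ((isOpen_compl_singleton (x := (0 : ℝ))).prod (isOpen_compl_singleton (x := (0 : ℝ))))
  exact this

end Calculus

/-! ### Coframes, their dual frames and the Monge relation -/

theorem altTwo_ext {A B : E8 [⋀^Fin 2]→L[ℝ] ℝ} (h : ∀ v w, A ![v, w] = B ![v, w]) : A = B := by
  ext x
  have : x = ![x 0, x 1] := by ext i; fin_cases i <;> rfl
  rw [this]
  exact h _ _

theorem fin8_forall {P : Fin 8 → Prop} (h0 : P 0) (h1 : P 1) (h2 : P 2) (h3 : P 3) (h4 : P 4)
    (h5 : P 5) (h6 : P 6) (h7 : P 7) : ∀ i, P i := by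
  intro i
  fin_cases i <;> assumption

theorem MongeRelatedOn.mono {U V : Set E8} {η ω : Forms8} (h : MongeRelatedOn U η ω)
    (hVU : V ⊆ U) : MongeRelatedOn V η ω := by
  obtain ⟨a, ha, h⟩ := h
  exact ⟨a, fun i j => (ha i j).mono hVU, fun p hp => h p (hVU hp)⟩

theorem MongeRelatedOn.trans {U : Set E8} {η ω θ : Forms8} (h₁ : MongeRelatedOn U η ω)
    (h₂ : MongeRelatedOn U ω θ) : MongeRelatedOn U η θ := by
  obtain ⟨a, ha, h₁⟩ := h₁
  obtain ⟨b, hb, h₂⟩ := h₂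
  refine ⟨fun p => b p * a p, fun i j => ?_, fun p hp => ⟨?_, fun i j hi hj => ?_, fun i => ?_⟩⟩
  · simp only [Matrix.mul_apply]
    exact ContDiffOn.sum fun k _ => (hb i k).mul (ha k j)
  · rw [Matrix.det_mul]
    exact mul_ne_zero (h₂ p hp).1 (h₁ p hp).1
  · change (b p * a p) i j = 0
    rw [Matrix.mul_apply]
    refine Finset.sum_eq_zero fun k _ => ?_
    -- The block of zeros survives multiplication: each summand has a factor in the zero block of a
    -- or of b.
    by_cases hk : (k : ℕ) < 5
    · rw [(h₁ p hp).2.1 k j hk hj, mul_zero]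
    · rw [(h₂ p hp).2.1 i k hi (not_lt.1 hk), zero_mul]
  · rw [(h₂ p hp).2.2 i]
    simp only [(h₁ p hp).2.2, Matrix.mul_apply, Finset.smul_sum, Finset.sum_smul, smul_smul]
    exact Finset.sum_comm

theorem IsCoframeOn.of_related {U : Set E8} {η ω : Forms8} (hη : IsCoframeOn U η)
    (h : MongeRelatedOn U η ω) : IsCoframeOn U ω := by
  obtain ⟨a, ha, h⟩ := h
  refine ⟨fun i => ?_, fun p hp => ?_⟩
  · refine ContDiffOn.congr (f := fun p => ∑ j, a p i j • η j p) ?_ fun p hp => (h p hp).2.2 i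
    exact ContDiffOn.sum fun j _ => (ha i j).smul (hη.1 j)
  · rw [Fintype.linearIndependent_iff]
    intro g hg
    have h1 : ∑ j, (Matrix.vecMul g (a p)) j • η j p = 0 := by
      rw [← hg]
      simp only [(h p hp).2.2, Matrix.vecMul, dotProduct, Finset.smul_sum, Finset.sum_smul,
        smul_smul]
      exact Finset.sum_comm
    have h2 := Fintype.linearIndependent_iff.1 (hη.2 p hp) _ h1
    have h3 := Matrix.eq_zero_of_vecMul_eq_zero (h p hp).1 (funext h2)
    exact fun i => congrFun h3 i

theorem IsCoframeOn.mono {U V : Set E8} {ω : Forms8} (h : IsCoframeOn U ω) (hVU : V ⊆ U) :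
    IsCoframeOn V ω :=
  ⟨fun i => (h.1 i).mono hVU, fun p hp => h.2 p (hVU hp)⟩

theorem oneForm_apply (α : E8 →L[ℝ] ℝ) (v : E8) : α v = ∑ l, α (Pi.single l 1) * v l := by
  conv_lhs => rw [← Finset.univ_sum_single v]
  rw [map_sum]
  refine Finset.sum_congr rfl fun l _ => ?_
  have : Pi.single l (v l) = v l • (Pi.single l 1 : E8) := by
    rw [← Pi.single_smul, smul_eq_mul, mul_one]
  rw [this, map_smul, smul_eq_mul, mul_comm]

theorem isUnit_det_of_linearIndependent {α : Fin 8 → E8 →L[ℝ] ℝ} (h : LinearIndependent ℝ α) :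
    IsUnit (Matrix.of fun i l : Fin 8 => α i (Pi.single l 1)).det := by
  rw [← Matrix.isUnit_iff_isUnit_det, ← Matrix.linearIndependent_rows_iff_isUnit,
    Fintype.linearIndependent_iff]
  intro g hg
  refine Fintype.linearIndependent_iff.1 h g ?_
  ext v
  rw [oneForm_apply]
  refine Finset.sum_eq_zero fun l _ => ?_
  have := congrFun hg l
  simp only [Finset.sum_apply, Pi.smul_apply, Matrix.row, Matrix.of_apply, Pi.zero_apply,
    smul_eq_mul] at this
  simp [this]

theorem apply_dualFrame {U : Set E8} {ω : Forms8} (h : IsCoframeOn U ω) {p : E8} (hp : p ∈ U)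
    (i k : Fin 8) : ω i p (dualFrame ω k p) = if i = k then 1 else 0 := by
  have h1 := Matrix.mul_nonsing_inv _ (isUnit_det_of_linearIndependent (h.2 p hp))
  have h2 := congrFun (congrFun h1 i) k
  rw [Matrix.mul_apply, Matrix.one_apply] at h2
  rw [oneForm_apply, ← h2]
  rfl

theorem eq_sum_dualFrame {U : Set E8} {ω : Forms8} (h : IsCoframeOn U ω) {p : E8} (hp : p ∈ U)
    (v : E8) : v = ∑ k, ω k p v • dualFrame ω k p := by
  have h1 := Matrix.nonsing_inv_mul _ (isUnit_det_of_linearIndependent (h.2 p hp))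
  set A : Matrix (Fin 8) (Fin 8) ℝ := Matrix.of fun i l : Fin 8 => ω i p (Pi.single l 1) with hA
  have h2 : A.mulVec v = fun k => ω k p v := by
    ext k
    rw [oneForm_apply]
    rfl
  have h3 : A⁻¹.mulVec (A.mulVec v) = v := by rw [Matrix.mulVec_mulVec, h1, Matrix.one_mulVec]
  rw [h2] at h3
  conv_lhs => rw [← h3]
  ext j
  simp only [Matrix.mulVec, dotProduct, Finset.sum_apply, Pi.smul_apply, smul_eq_mul]
  exact Finset.sum_congr rfl fun k _ => mul_comm _ _

/-! ### Invariants when u depends on a primitive of ω⁷ alone -/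

section Invariants

variable {O : Set E8} {ω : Forms8} {u y : E8 → ℝ} {h : ℝ → ℝ} {J : Set ℝ}

/-- By the chain rule df = g' ω⁷, so only the coefficient at ω⁷ (index 6) survives. -/
theorem coeffD_comp (hO : IsOpen O) (hω : IsCoframeOn O ω) {f : E8 → ℝ} {g : ℝ → ℝ} {g' : ℝ}
    {p : E8} (hp : p ∈ O) (hy : HasFDerivAt y (ω 6 p) p) (hg : HasDerivAt g g' (y p))
    (hf : ∀ q ∈ O, f q = g (y q)) (k : Fin 8) :
    coeffD ω k f p = if 6 = k then g' else 0 := by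
  have h1 : HasFDerivAt f (g' • ω 6 p) p :=
    (hg.comp_hasFDerivAt p hy).congr_of_eventuallyEq (eventually_of_mem (hO.mem_nhds hp) hf)
  rw [coeffD, h1.fderiv]
  simp [apply_dualFrame hω hp]

/-- Each application of ∂₇ raises the order of the derivative of h by one. Equalities are kept on
all of the open set O, because the next differentiation needs them in a neighbourhood. -/
theorem invariants_of_comp (hO : IsOpen O) (hω : IsCoframeOn O ω)
    (hy : ∀ p ∈ O, HasFDerivAt y (ω 6 p) p) (hJ : IsOpen J) (hh : ContDiffOn ℝ (⊤ : ℕ∞) h J)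
    (hyJ : ∀ p ∈ O, y p ∈ J) (hu : ∀ p ∈ O, u p = 1 / 2 * iteratedDeriv 3 h (y p))
    {p : E8} (hp : p ∈ O) :
    I₂ ω u p = 0 ∧ I₁ ω u p = 1 / 4 * discr h (y p) ∧ S₄ ω u p = s4Formula h (y p) := by
  have hd : ∀ (n : ℕ), ∀ q ∈ O, HasDerivAt (fun x => 1 / 2 * iteratedDeriv n h x)
      (1 / 2 * iteratedDeriv (n + 1) h (y q)) (y q) := fun n q hq =>
    (hasDerivAt_iteratedDeriv hJ hh n (hyJ q hq)).const_mul _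
  have e1 : v₁ ω u p = 0 := coeffD_comp hO hω hp (hy p hp) (hd 3 p hp) hu 1
  have e2 : ∀ q ∈ O, v₂ ω u q = 1 / 2 * iteratedDeriv 4 h (y q) := fun q hq =>
    coeffD_comp hO hω hq (hy q hq) (hd 3 q hq) hu 6
  have e3 : ∀ q ∈ O, w₃ ω u q = 1 / 2 * iteratedDeriv 5 h (y q) := fun q hq =>
    coeffD_comp hO hω hq (hy q hq) (hd 4 q hq) e2 6
  have e4 : z₄ ω u p = 1 / 2 * iteratedDeriv 6 h (y p) :=
    coeffD_comp hO hω hp (hy p hp) (hd 5 p hp) e3 6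
  have e5 : I₁ ω u p = 1 / 4 * discr h (y p) := by
    rw [I₁, e2 p hp, e3 p hp, hu p hp, discr]
    ring
  refine ⟨e1, e5, ?_⟩
  -- The case of discriminant zero is included, so the formula for S₄ needs no hypothesis I₁ ≠ 0:
  -- both denominators are then 0.
  have hsign : Real.sign (1 / 4 * discr h (y p)) = Real.sign (discr h (y p)) := by
    rcases lt_trichotomy (discr h (y p)) 0 with hlt | heq | hgt
    · rw [Real.sign_of_neg hlt, Real.sign_of_neg (by linarith)]
    · rw [heq, mul_zero]
    · rw [Real.sign_of_pos hgt, Real.sign_of_pos (by linarith)]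
  have hsqrt : Real.sqrt (Real.sign (1 / 4 * discr h (y p)) * (1 / 4 * discr h (y p)) ^ 3) =
      1 / 8 * Real.sqrt (Real.sign (discr h (y p)) * discr h (y p) ^ 3) := by
    rw [hsign, show Real.sign (discr h (y p)) * (1 / 4 * discr h (y p)) ^ 3 =
      (1 / 8) ^ 2 * (Real.sign (discr h (y p)) * discr h (y p) ^ 3) by ring,
      Real.sqrt_mul (by positivity), Real.sqrt_sq (by positivity)]
  rw [S₄, s4Formula, e5, hsqrt, e2 p hp, hu p hp, e4]
  rw [show 2 * (1 / 8 * Real.sqrt (Real.sign (discr h (y p)) * discr h (y p) ^ 3)) =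
    1 / 4 * Real.sqrt (Real.sign (discr h (y p)) * discr h (y p) ^ 3) by ring]
  rw [← mul_div_mul_left _ (Real.sqrt _) (show (1 / 4 : ℝ) ≠ 0 by norm_num)]
  congr 1
  rw [discr]
  ring

end Invariants

theorem d_apply_of_hasFDerivAt {α : OneForm} {α' : E8 →L[ℝ] E8 →L[ℝ] ℝ} {p : E8}
    (h : HasFDerivAt α α' p) (v w : E8) : α.d p ![v, w] = α' v w - α' w v := by
  rw [OneForm.d_apply h.differentiableAt, h.fderiv]

/-- This triangular shape is used in both directions: to pass from the canonical coframe to the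
model coframe, and from an adapted coframe to the pulled-back canonical one. -/
theorem mongeRelatedOn_of_eqs {U : Set E8} {η ω : Forms8} {a b c d : E8 → ℝ}
    (ha : ContDiffOn ℝ (⊤ : ℕ∞) a U) (hb : ContDiffOn ℝ (⊤ : ℕ∞) b U) (hc : ContDiffOn ℝ (⊤ : ℕ∞) c U)
    (hd : ContDiffOn ℝ (⊤ : ℕ∞) d U)
    (h : ∀ p ∈ U, ω 0 p = -η 0 p + a p • η 3 p + b p • η 4 p ∧
      ω 1 p = -η 1 p + (2 * a p) • η 4 p ∧
      ω 2 p = c p • η 1 p - η 2 p + (2 * b p) • η 3 p + d p • η 4 p ∧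
      ω 3 p = η 3 p ∧ ω 4 p = η 4 p ∧ ω 5 p = η 5 p ∧ ω 6 p = η 6 p ∧ ω 7 p = -η 7 p) :
    MongeRelatedOn U η ω := by
  have h2a : ContDiffOn ℝ (⊤ : ℕ∞) (fun p => 2 * a p) U := contDiffOn_const.mul ha
  have h2b : ContDiffOn ℝ (⊤ : ℕ∞) (fun p => 2 * b p) U := contDiffOn_const.mul hb
  refine ⟨fun p => Matrix.of ![![-1, 0, 0, a p, b p, 0, 0, 0], ![0, -1, 0, 0, 2 * a p, 0, 0, 0],
    ![0, c p, -1, 2 * b p, d p, 0, 0, 0], ![0, 0, 0, 1, 0, 0, 0, 0], ![0, 0, 0, 0, 1, 0, 0, 0],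
    ![0, 0, 0, 0, 0, 1, 0, 0], ![0, 0, 0, 0, 0, 0, 1, 0], ![0, 0, 0, 0, 0, 0, 0, -1]],
    fun i j => ?_, fun p hp => ⟨?_, fun i j hi hj => ?_, ?_⟩⟩
  · fin_cases i <;> fin_cases j <;>
      first
        | exact contDiffOn_const
        | exact ha
        | exact hb
        | exact hc
        | exact hd
        | exact h2a
        | exact h2b
  -- Nonsingularity is shown through the kernel: entries 3 to 7 of a kernel vector vanish at once,
  -- then 0 and 1, then 2.
  · intro hdet
    obtain ⟨v, hv, hv0⟩ := Matrix.exists_mulVec_eq_zero_iff.2 hdet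
    apply hv
    have k0 := congrFun hv0 0
    have k1 := congrFun hv0 1
    have k2 := congrFun hv0 2
    have k3 := congrFun hv0 3
    have k4 := congrFun hv0 4
    have k5 := congrFun hv0 5
    have k6 := congrFun hv0 6
    have k7 := congrFun hv0 7
    simp [Matrix.mulVec, dotProduct, Fin.sum_univ_eight] at k0 k1 k2 k3 k4 k5 k6 k7
    funext i
    revert i
    simp only [k3, k4, mul_zero, add_zero, neg_eq_zero] at k0 k1
    simp only [k1, k3, k4, mul_zero, add_zero, zero_add, neg_eq_zero] at k2
    exact fin8_forall k0 k1 k2 k3 k4 k5 k6 k7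
  · fin_cases i <;> first | (exfalso; revert hi; decide) | skip
    all_goals fin_cases j <;> first | (exfalso; revert hj; decide) | rfl
  · obtain ⟨e0, e1, e2, e3, e4, e5, e6, e7⟩ := h p hp
    refine fin8_forall ?_ ?_ ?_ ?_ ?_ ?_ ?_ ?_ <;>
      simp [Fin.sum_univ_eight, *, sub_eq_add_neg]
    all_goals exact (neg_one_smul ℝ _).symm

/-! ### The adapted coframe of the normal form -/

section ModelCoframe

/-- The adapted coframe of the Monge system `MongeSystem.ofFun h`. -/
noncomputable def modelCoframe (h : ℝ → ℝ) : Forms8 :=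
  ![fun p => p 3 • dcoord 2 + p 4 • dcoord 1 - (p 3 * p 4) • dcoord 0 - dcoord 6,
    fun p => (2 * p 3) • dcoord 1 - (p 3 * p 3) • dcoord 0 - dcoord 5,
    fun p => (2 * p 4) • dcoord 2 - (p 4 * p 4) • dcoord 0
      + (iteratedDeriv 2 h (p 3) / 2) • dcoord 5
      + (iteratedDeriv 1 h (p 3) - p 3 * iteratedDeriv 2 h (p 3)) • dcoord 1
      + (p 3 * p 3 * (iteratedDeriv 2 h (p 3) / 2) - p 3 * iteratedDeriv 1 h (p 3)
        + iteratedDeriv 0 h (p 3)) • dcoord 0 - dcoord 7,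
    fun p => dcoord 2 - p 4 • dcoord 0,
    fun p => dcoord 1 - p 3 • dcoord 0,
    fun _ => dcoord 4,
    fun _ => dcoord 3,
    fun _ => -dcoord 0]

variable {h : ℝ → ℝ} {J : Set ℝ}

theorem mongeRelatedOn_modelCoframe (hJ : IsOpen J) (hh : ContDiffOn ℝ (⊤ : ℕ∞) h J) :
    MongeRelatedOn (MongeSystem.ofFun h J hJ hh).space
      (MongeSystem.ofFun h J hJ hh).coframe (modelCoframe h) := by
  have h3 : ContDiffOn ℝ (⊤ : ℕ∞) (fun p : E8 => p 3) (MongeSystem.ofFun h J hJ hh).space := by fun_prop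
  have hc : ∀ n, ContDiffOn ℝ (⊤ : ℕ∞) (fun p : E8 => iteratedDeriv n h (p 3))
      (MongeSystem.ofFun h J hJ hh).space := fun n =>
    (contDiffOn_iteratedDeriv hJ hh n).comp h3 fun p hp => hp
  refine mongeRelatedOn_of_eqs (a := fun p => p 3) (b := fun p => p 4)
    (c := fun p => iteratedDeriv 2 h (p 3) / 2)
    (d := fun p => iteratedDeriv 1 h (p 3) - p 3 * iteratedDeriv 2 h (p 3))
    h3 (by fun_prop) ((hc 2).div_const _) ((hc 1).sub (h3.mul (hc 2))) fun p _ => ?_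
  refine ⟨?_, ?_, ?_, ?_, ?_, ?_, ?_, ?_⟩ <;> ext v <;>
    simp [modelCoframe, MongeSystem.coframe, MongeSystem.ofFun] <;> ring

theorem satisfiesEDS_modelCoframe (hJ : IsOpen J) (hh : ContDiffOn ℝ (⊤ : ℕ∞) h J)
    (h3 : ∀ x ∈ J, iteratedDeriv 3 h x ≠ 0) :
    SatisfiesEDS (MongeSystem.ofFun h J hJ hh).space (modelCoframe h)
      fun p => 1 / 2 * iteratedDeriv 3 h (p 3) := by
  have hx : ∀ (k : Fin 8) (p : E8), HasFDerivAt (fun q : E8 => q k) (dcoord k) p :=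
    fun k p => hasFDerivAt_apply k p
  have hg : ∀ n, ∀ p ∈ (MongeSystem.ofFun h J hJ hh).space,
      HasFDerivAt (fun q : E8 => iteratedDeriv n h (q 3))
        (iteratedDeriv (n + 1) h (p 3) • dcoord 3) p := fun n p hp =>
    HasDerivAt.comp_hasFDerivAt (h₂ := iteratedDeriv n h) (f := fun q : E8 => q 3) p
      (hasDerivAt_iteratedDeriv hJ hh n hp) (hx 3 p)
  refine ⟨(MongeSystem.ofFun h J hJ hh).isOpen_space,
    (MongeSystem.ofFun h J hJ hh).isCoframeOn_coframe.of_related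
      (mongeRelatedOn_modelCoframe hJ hh), ?_, fun p hp => ?_,
    fun p hp => altTwo_ext fun v w => ?_, fun p hp => altTwo_ext fun v w => ?_,
    fun p hp => altTwo_ext fun v w => ?_, fun p hp => altTwo_ext fun v w => ?_,
    fun p hp => altTwo_ext fun v w => ?_, fun p hp => altTwo_ext fun v w => ?_,
    fun p hp => altTwo_ext fun v w => ?_, fun p hp => altTwo_ext fun v w => ?_⟩
  · have h3 : ContDiffOn ℝ (⊤ : ℕ∞) (fun p : E8 => p 3) (MongeSystem.ofFun h J hJ hh).space := by
      fun_prop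
    exact contDiffOn_const.mul ((contDiffOn_iteratedDeriv hJ hh 3).comp h3 fun p hp => hp)
  · exact mul_ne_zero (by norm_num) (h3 _ hp)
  · have := (((((hx 3 p).smul_const (dcoord 2)).add ((hx 4 p).smul_const (dcoord 1))).sub
      (((hx 3 p).mul (hx 4 p)).smul_const (dcoord 0))).sub_const (dcoord 6))
    rw [show (modelCoframe h 0).d p ![v, w] = _ from d_apply_of_hasFDerivAt this v w]
    simp only [ContinuousAlternatingMap.sub_apply, ContinuousAlternatingMap.neg_apply,
      OneForm.wedge_apply]
    simp [modelCoframe, dcoord]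
    ring
  · have := ((((hx 3 p).const_mul 2).smul_const (dcoord 1)).sub
      (((hx 3 p).mul (hx 3 p)).smul_const (dcoord 0))).sub_const (dcoord 5)
    rw [show (modelCoframe h 1).d p ![v, w] = _ from d_apply_of_hasFDerivAt this v w]
    simp only [ContinuousAlternatingMap.smul_apply, OneForm.wedge_apply]
    simp [modelCoframe, dcoord]
    ring
  · have g0 := hg 0 p hp
    have g1 := hg 1 p hp
    -- The derivative is taken of h'' * 2⁻¹ and rewritten as a division, to match the coefficient in
    -- `modelCoframe` literally.
    have g2 := (hg 2 p hp).mul_const (2⁻¹ : ℝ)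
    simp only [← div_eq_mul_inv] at g2
    have := ((((((((hx 4 p).const_mul 2).smul_const (dcoord 2)).sub
      (((hx 4 p).mul (hx 4 p)).smul_const (dcoord 0))).add (g2.smul_const (dcoord 5))).add
      ((g1.sub ((hx 3 p).mul (hg 2 p hp))).smul_const (dcoord 1))).add
      ((((((hx 3 p).mul (hx 3 p)).mul g2).sub ((hx 3 p).mul g1)).add g0).smul_const
        (dcoord 0))).sub_const (dcoord 7))
    rw [show (modelCoframe h 2).d p ![v, w] = _ from d_apply_of_hasFDerivAt this v w]
    simp only [ContinuousAlternatingMap.sub_apply, ContinuousAlternatingMap.smul_apply,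
      OneForm.wedge_apply]
    simp [modelCoframe, dcoord]
    ring
  · have := ((hx 4 p).smul_const (dcoord 0)).const_sub (dcoord 2)
    rw [show (modelCoframe h 3).d p ![v, w] = _ from d_apply_of_hasFDerivAt this v w]
    simp only [OneForm.wedge_apply]
    simp [modelCoframe, dcoord]
  · have := ((hx 3 p).smul_const (dcoord 0)).const_sub (dcoord 1)
    rw [show (modelCoframe h 4).d p ![v, w] = _ from d_apply_of_hasFDerivAt this v w]
    simp only [OneForm.wedge_apply]
    simp [modelCoframe, dcoord]
  · rw [show (modelCoframe h 5).d p ![v, w] = _ from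
      d_apply_of_hasFDerivAt (hasFDerivAt_const (dcoord 4) p) v w]
    simp
  · rw [show (modelCoframe h 6).d p ![v, w] = _ from
      d_apply_of_hasFDerivAt (hasFDerivAt_const (dcoord 3) p) v w]
    simp
  · rw [show (modelCoframe h 7).d p ![v, w] = _ from
      d_apply_of_hasFDerivAt (hasFDerivAt_const (-dcoord 0) p) v w]
    simp

end ModelCoframe

/-! ### Structure equations on vectors and the integrability condition -/

namespace SatisfiesEDS

variable {W : Set E8} {ω : Forms8} {u : E8 → ℝ} {p : E8}

theorem differentiableAt (H : SatisfiesEDS W ω u) (hp : p ∈ W) (i : Fin 8) :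
    DifferentiableAt ℝ (ω i) p :=
  ((H.isCoframe.1 i).contDiffAt (H.isOpen.mem_nhds hp)).differentiableAt (by simp)

theorem hasFDerivAt (H : SatisfiesEDS W ω u) (hp : p ∈ W) (i : Fin 8) :
    HasFDerivAt (ω i) (fderiv ℝ (ω i) p) p :=
  (H.differentiableAt hp i).hasFDerivAt

theorem d1_apply (H : SatisfiesEDS W ω u) (hp : p ∈ W) (v w : E8) :
    fderiv ℝ (ω 0) p v w - fderiv ℝ (ω 0) p w v =
      -(ω 3 p v * ω 6 p w - ω 3 p w * ω 6 p v) - (ω 4 p v * ω 5 p w - ω 4 p w * ω 5 p v) := by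
  rw [← OneForm.d_apply (H.differentiableAt hp 0), H.d1 p hp]
  simp only [ContinuousAlternatingMap.sub_apply, ContinuousAlternatingMap.neg_apply,
    OneForm.wedge_apply]

theorem d2_apply (H : SatisfiesEDS W ω u) (hp : p ∈ W) (v w : E8) :
    fderiv ℝ (ω 1) p v w - fderiv ℝ (ω 1) p w v =
      -2 * (ω 4 p v * ω 6 p w - ω 4 p w * ω 6 p v) := by
  rw [← OneForm.d_apply (H.differentiableAt hp 1), H.d2 p hp]
  simp only [ContinuousAlternatingMap.smul_apply, OneForm.wedge_apply, smul_eq_mul]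

theorem d3_apply (H : SatisfiesEDS W ω u) (hp : p ∈ W) (v w : E8) :
    fderiv ℝ (ω 2) p v w - fderiv ℝ (ω 2) p w v =
      u p * (ω 1 p v * ω 6 p w - ω 1 p w * ω 6 p v) -
        2 * (ω 3 p v * ω 5 p w - ω 3 p w * ω 5 p v) := by
  rw [← OneForm.d_apply (H.differentiableAt hp 2), H.d3 p hp]
  simp only [ContinuousAlternatingMap.sub_apply, ContinuousAlternatingMap.smul_apply,
    OneForm.wedge_apply, smul_eq_mul]

theorem d4_apply (H : SatisfiesEDS W ω u) (hp : p ∈ W) (v w : E8) :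
    fderiv ℝ (ω 3) p v w - fderiv ℝ (ω 3) p w v =
      ω 5 p v * ω 7 p w - ω 5 p w * ω 7 p v := by
  rw [← OneForm.d_apply (H.differentiableAt hp 3), H.d4 p hp, OneForm.wedge_apply]

theorem d5_apply (H : SatisfiesEDS W ω u) (hp : p ∈ W) (v w : E8) :
    fderiv ℝ (ω 4) p v w - fderiv ℝ (ω 4) p w v =
      ω 6 p v * ω 7 p w - ω 6 p w * ω 7 p v := by
  rw [← OneForm.d_apply (H.differentiableAt hp 4), H.d5 p hp, OneForm.wedge_apply]

theorem d6_apply (H : SatisfiesEDS W ω u) (hp : p ∈ W) (v w : E8) :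
    fderiv ℝ (ω 5) p v w - fderiv ℝ (ω 5) p w v = 0 := by
  rw [← OneForm.d_apply (H.differentiableAt hp 5), H.d6 p hp]
  simp

theorem d7_apply (H : SatisfiesEDS W ω u) (hp : p ∈ W) (v w : E8) :
    fderiv ℝ (ω 6) p v w - fderiv ℝ (ω 6) p w v = 0 := by
  rw [← OneForm.d_apply (H.differentiableAt hp 6), H.d7 p hp]
  simp

theorem d8_apply (H : SatisfiesEDS W ω u) (hp : p ∈ W) (v w : E8) :
    fderiv ℝ (ω 7) p v w - fderiv ℝ (ω 7) p w v = 0 := by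
  rw [← OneForm.d_apply (H.differentiableAt hp 7), H.d8 p hp]
  simp

/-- The integrability condition `du ∧ ω² ∧ ω⁷ = 0`, a consequence of `d(dω³) = 0`. -/
theorem du_wedge_eq_zero (H : SatisfiesEDS W ω u) (hp : p ∈ W) (a b c : E8) :
    fderiv ℝ u p a * (ω 1 p b * ω 6 p c - ω 1 p c * ω 6 p b) +
      fderiv ℝ u p b * (ω 1 p c * ω 6 p a - ω 1 p a * ω 6 p c) +
      fderiv ℝ u p c * (ω 1 p a * ω 6 p b - ω 1 p b * ω 6 p a) = 0 := by
  have hW := H.isOpen.mem_nhds hp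
  have hα := (H.isCoframe.1 2).contDiffAt hW
  have hsymm : IsSymmSndFDerivAt ℝ (ω 2) p := hα.isSymmSndFDerivAt (by
    rw [minSmoothness_of_isRCLikeNormedField]
    exact WithTop.coe_le_coe.2 (le_top : (2 : ℕ∞) ≤ ⊤))
  have hD : HasFDerivAt (fderiv ℝ (ω 2)) (fderiv ℝ (fderiv ℝ (ω 2)) p) p :=
    ((((contDiffOn_infty_iff_fderiv_of_isOpen H.isOpen).1 (H.isCoframe.1 2)).2.contDiffAt
      hW).differentiableAt (by simp)).hasFDerivAt
  have hu : HasFDerivAt u (fderiv ℝ u p) p :=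
    ((H.smooth_u.contDiffAt hW).differentiableAt (by simp)).hasFDerivAt
  have hev : ∀ (i : Fin 8) (x : E8),
      HasFDerivAt (fun q => ω i q x) ((fderiv ℝ (ω i) p).flip x) p := fun i x =>
    ((H.hasFDerivAt hp i).clm_apply (hasFDerivAt_const x p)).congr_fderiv (by ext; simp)
  -- The equation for dω³(b, c), differentiated in the direction a.
  have key : ∀ a b c : E8, fderiv ℝ (fderiv ℝ (ω 2)) p a b c - fderiv ℝ (fderiv ℝ (ω 2)) p a c b =
      fderiv ℝ u p a * (ω 1 p b * ω 6 p c - ω 1 p c * ω 6 p b) +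
      u p * (fderiv ℝ (ω 1) p a b * ω 6 p c + ω 1 p b * fderiv ℝ (ω 6) p a c -
        fderiv ℝ (ω 1) p a c * ω 6 p b - ω 1 p c * fderiv ℝ (ω 6) p a b) -
      2 * (fderiv ℝ (ω 3) p a b * ω 5 p c + ω 3 p b * fderiv ℝ (ω 5) p a c -
        fderiv ℝ (ω 3) p a c * ω 5 p b - ω 3 p c * fderiv ℝ (ω 5) p a b) := by
    intro a b c
    have hl : HasFDerivAt (fun q => fderiv ℝ (ω 2) q b c - fderiv ℝ (ω 2) q c b)
        (((fderiv ℝ (fderiv ℝ (ω 2)) p).flip b).flip c -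
          ((fderiv ℝ (fderiv ℝ (ω 2)) p).flip c).flip b) p := by
      have h1 : ∀ x y : E8, HasFDerivAt (fun q => fderiv ℝ (ω 2) q x y)
          (((fderiv ℝ (fderiv ℝ (ω 2)) p).flip x).flip y) p := fun x y =>
        ((hD.clm_apply (hasFDerivAt_const x p)).clm_apply (hasFDerivAt_const y p)).congr_fderiv
          (by ext; simp)
      exact (h1 b c).sub (h1 c b)
    have hr := (hu.mul (((hev 1 b).mul (hev 6 c)).sub ((hev 1 c).mul (hev 6 b)))).sub
      ((((hev 3 b).mul (hev 5 c)).sub ((hev 3 c).mul (hev 5 b))).const_mul 2)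
    have := hl.unique (hr.congr_of_eventuallyEq
      (eventually_of_mem hW fun q hq => H.d3_apply hq b c))
    have := DFunLike.congr_fun this a
    simp at this
    linear_combination this
  have s := fun x y z : E8 => DFunLike.congr_fun (hsymm.eq x y) z
  -- In the cyclic sum the second derivatives of ω³ cancel by symmetry. The terms other than du ∧ ω²
  -- ∧ ω⁷ vanish: dω² ∧ ω⁷ and dω⁴ ∧ ω⁶ have a repeated factor, and dω⁶ = dω⁷ = 0.
  linear_combination -key a b c - key b c a - key c a b
    + s a b c + s b c a + s c a b
    - u p * (ω 6 p c * H.d2_apply hp a b + ω 6 p a * H.d2_apply hp b c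
      + ω 6 p b * H.d2_apply hp c a)
    + u p * (ω 1 p c * H.d7_apply hp a b + ω 1 p a * H.d7_apply hp b c
      + ω 1 p b * H.d7_apply hp c a)
    + 2 * (ω 5 p c * H.d4_apply hp a b + ω 5 p a * H.d4_apply hp b c
      + ω 5 p b * H.d4_apply hp c a)
    - 2 * (ω 3 p c * H.d6_apply hp a b + ω 3 p a * H.d6_apply hp b c
      + ω 3 p b * H.d6_apply hp c a)

theorem fderiv_eq_smul (H : SatisfiesEDS W ω u) (hp : p ∈ W) (hI : I₂ ω u p = 0) :
    fderiv ℝ u p = v₂ ω u p • ω 6 p := by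
  have hk : ∀ k : Fin 8, k ≠ 6 → fderiv ℝ u p (dualFrame ω k p) = 0 := by
    intro k hk6
    by_cases hk1 : k = 1
    · subst hk1
      exact hI
    -- On (E_k, E₂, E₇) with k ≠ 2, 7 the condition reduces to du(E_k) = 0.
    · have := H.du_wedge_eq_zero hp (dualFrame ω k p) (dualFrame ω 1 p) (dualFrame ω 6 p)
      simpa [apply_dualFrame H.isCoframe hp, Ne.symm hk6, Ne.symm hk1] using this
  ext v
  conv_lhs => rw [eq_sum_dualFrame H.isCoframe hp v]
  rw [map_sum, Finset.sum_eq_single 6]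
  · simp [v₂, coeffD, mul_comm]
  · intro k _ h6
    simp [hk k h6]
  · simp

end SatisfiesEDS

/-! ### Integration to the normal form -/

theorem exists_linearEquiv_of_coframe {ω : Forms8} {U : Set E8} (hω : IsCoframeOn U ω) {p : E8}
    (hp : p ∈ U) {A : E8 →L[ℝ] E8} (hA : ∀ v, A v = 0 → ∀ i, ω i p v = 0) :
    ∃ e : E8 ≃L[ℝ] E8, (e : E8 →L[ℝ] E8) = A := by
  have hinj : Function.Injective (A : E8 →ₗ[ℝ] E8) := by
    rw [← LinearMap.ker_eq_bot, LinearMap.ker_eq_bot']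
    intro v hv
    rw [eq_sum_dualFrame hω hp v]
    exact Finset.sum_eq_zero fun k _ => by rw [hA v hv k, zero_smul]
  exact ⟨(LinearEquiv.ofInjectiveEndo (A : E8 →ₗ[ℝ] E8) hinj).toContinuousLinearEquiv, by
    ext v; rfl⟩

theorem exists_isLocalEquivalence_ofFun {S : MongeStructure} {W : Set E8} {ω : Forms8}
    {u : E8 → ℝ} (H : S.IsAdapted W ω u) (hI₁ : ∀ p ∈ W, I₁ ω u p ≠ 0)
    (hI₂ : ∀ p ∈ W, I₂ ω u p = 0) {p : E8} (hp : p ∈ W) :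
    ∃ (h : ℝ → ℝ) (J : Set ℝ) (hJ : IsOpen J) (hh : ContDiffOn ℝ (⊤ : ℕ∞) h J)
        (φ : OpenPartialHomeomorph E8 E8),
        IsLocalEquivalence S (MongeSystem.ofFun h J hJ hh).toStructure φ ∧
        p ∈ φ.source ∧ φ.source ⊆ W ∧
        (∀ x ∈ J, iteratedDeriv 3 h x ≠ 0 ∧ discr h x ≠ 0) ∧
        ∀ q ∈ φ.source,
          I₁ ω u q = 1 / 4 * discr h (φ q 3) ∧ S₄ ω u q = s4Formula h (φ q 3) := by
  have N := H.eds
  obtain ⟨R, hR, hRW⟩ := Metric.isOpen_iff.1 N.isOpen p hp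
  set B := Metric.ball p R with hBdef
  have hBo : IsOpen B := Metric.isOpen_ball
  have hBc : Convex ℝ B := convex_ball p R
  have hpB : p ∈ B := Metric.mem_ball_self hR
  have hc : ∀ i, ContDiffOn ℝ (⊤ : ℕ∞) (ω i) B := fun i => (N.isCoframe.1 i).mono hRW
  obtain ⟨t, ht, htd⟩ := exists_smooth_primitive_of_closed hBc hBo (α := fun q => -ω 7 q)
    (hc 7).neg fun q hq => ⟨_, (N.hasFDerivAt (hRW hq) 7).neg, fun v w => by
      simp only [neg_apply]
      linear_combination -N.d8_apply (hRW hq) v w⟩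
  obtain ⟨y₁, hy₁, hy₁d⟩ := exists_smooth_primitive_of_closed hBc hBo (α := ω 6)
    (hc 6) fun q hq => ⟨_, N.hasFDerivAt (hRW hq) 6, fun v w => by
      linear_combination N.d7_apply (hRW hq) v w⟩
  obtain ⟨y₂, hy₂, hy₂d⟩ := exists_smooth_primitive_of_closed hBc hBo (α := ω 5)
    (hc 5) fun q hq => ⟨_, N.hasFDerivAt (hRW hq) 5, fun v w => by
      linear_combination N.d6_apply (hRW hq) v w⟩
  -- Closed because d(y₁ω⁸) = ω⁷ ∧ ω⁸ = dω⁵; as ω⁸ = -dt, this reads ω⁵ = dx₁ - y₁ dt.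
  obtain ⟨x₁, hx₁, hx₁d⟩ := exists_smooth_primitive_of_closed hBc hBo
    (α := fun q => ω 4 q - y₁ q • ω 7 q)
    ((hc 4).sub (hy₁.smul (hc 7))) fun q hq => ⟨_, (N.hasFDerivAt (hRW hq) 4).sub
      ((hy₁d q hq).smul (N.hasFDerivAt (hRW hq) 7)), fun v w => by
      simp
      linear_combination N.d5_apply (hRW hq) v w - y₁ q * N.d8_apply (hRW hq) v w⟩
  obtain ⟨x₂, hx₂, hx₂d⟩ := exists_smooth_primitive_of_closed hBc hBo
    (α := fun q => ω 3 q - y₂ q • ω 7 q)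
    ((hc 3).sub (hy₂.smul (hc 7))) fun q hq => ⟨_, (N.hasFDerivAt (hRW hq) 3).sub
      ((hy₂d q hq).smul (N.hasFDerivAt (hRW hq) 7)), fun v w => by
      simp
      linear_combination N.d4_apply (hRW hq) v w - y₂ q * N.d8_apply (hRW hq) v w⟩
  -- The term 2y₁ω⁵ compensates dω² = -2ω⁵ ∧ ω⁷, and y₁²ω⁸ compensates the resulting 2y₁ω⁷ ∧ ω⁸. The
  -- form for z₁₂ is the polarized version.
  obtain ⟨z₁₁, hz₁₁, hz₁₁d⟩ := exists_smooth_primitive_of_closed hBc hBo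
    (α := fun q => -ω 1 q + (2 * y₁ q) • ω 4 q - (y₁ q * y₁ q) • ω 7 q)
    (((hc 1).neg.add ((contDiffOn_const.mul hy₁).smul (hc 4))).sub ((hy₁.mul hy₁).smul (hc 7)))
    fun q hq => ⟨_, ((N.hasFDerivAt (hRW hq) 1).neg.add
      (((hy₁d q hq).const_mul 2).smul (N.hasFDerivAt (hRW hq) 4))).sub
      (((hy₁d q hq).mul (hy₁d q hq)).smul (N.hasFDerivAt (hRW hq) 7)), fun v w => by
      simp
      linear_combination -N.d2_apply (hRW hq) v w + 2 * y₁ q * N.d5_apply (hRW hq) v w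
        - y₁ q * y₁ q * N.d8_apply (hRW hq) v w⟩
  obtain ⟨z₁₂, hz₁₂, hz₁₂d⟩ := exists_smooth_primitive_of_closed hBc hBo
    (α := fun q => -ω 0 q + y₁ q • ω 3 q + y₂ q • ω 4 q - (y₁ q * y₂ q) • ω 7 q)
    ((((hc 0).neg.add (hy₁.smul (hc 3))).add (hy₂.smul (hc 4))).sub ((hy₁.mul hy₂).smul (hc 7)))
    fun q hq => ⟨_, (((N.hasFDerivAt (hRW hq) 0).neg.add
      ((hy₁d q hq).smul (N.hasFDerivAt (hRW hq) 3))).add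
      ((hy₂d q hq).smul (N.hasFDerivAt (hRW hq) 4))).sub
      (((hy₁d q hq).mul (hy₂d q hq)).smul (N.hasFDerivAt (hRW hq) 7)), fun v w => by
      simp
      linear_combination -N.d1_apply (hRW hq) v w + y₁ q * N.d4_apply (hRW hq) v w
        + y₂ q * N.d5_apply (hRW hq) v w - y₁ q * y₂ q * N.d8_apply (hRW hq) v w⟩
  -- `u` is half the third derivative of a function of `y₁`
  obtain ⟨U, r, V, hr, hU, hVo, hpV, hVB, hVU⟩ := exists_eq_comp_of_fderiv_eq_smul hBo hy₁
    (N.smooth_u.mono hRW) (c := v₂ ω u)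
    (fun q hq => by rw [(hy₁d q hq).fderiv]; exact N.fderiv_eq_smul (hRW hq) (hI₂ q (hRW hq)))
    hpB (by rw [(hy₁d p hpB).fderiv]; exact (N.isCoframe.2 p hp).ne_zero 6)
  obtain ⟨h, hh₀, hhU⟩ := exists_smooth_iteratedDeriv_eq (convex_ball (y₁ p) r)
    Metric.isOpen_ball 3 (contDiffOn_const.mul hU : ContDiffOn ℝ (⊤ : ℕ∞) (fun x => 2 * U x) _)
  have huV : ∀ q ∈ V, u q = 1 / 2 * iteratedDeriv 3 h (y₁ q) := fun q hq => by
    rw [hhU (hVU q hq).1, (hVU q hq).2]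
    ring
  have hinv : ∀ q ∈ V, I₂ ω u q = 0 ∧ I₁ ω u q = 1 / 4 * discr h (y₁ q) ∧
      S₄ ω u q = s4Formula h (y₁ q) := fun q hq =>
    invariants_of_comp hVo (N.isCoframe.mono (hVB.trans hRW)) (fun q hq => hy₁d q (hVB hq))
      Metric.isOpen_ball hh₀ (fun q hq => (hVU q hq).1) huV hq
  -- The nonvanishing conditions must hold on all of J, so J is cut down to where they hold; it
  -- still contains every value of y₁ on V.
  set J := {x ∈ Metric.ball (y₁ p) r | iteratedDeriv 3 h x ≠ 0 ∧ discr h x ≠ 0} with hJdef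
  have hJ : IsOpen J := isOpen_discr_ne_zero Metric.isOpen_ball hh₀
  have hh : ContDiffOn ℝ (⊤ : ℕ∞) h J := hh₀.mono fun x hx => hx.1
  have hyJ : ∀ q ∈ V, y₁ q ∈ J := fun q hq => by
    have hqW := hRW (hVB hq)
    refine ⟨(hVU q hq).1, fun h0 => N.u_ne_zero q hqW ?_, fun h0 => hI₁ q hqW ?_⟩
    · rw [huV q hq, h0, mul_zero]
    · rw [(hinv q hq).2.1, h0, mul_zero]
  -- V need not be convex; a smaller ball is needed to apply the Poincaré lemma again.
  obtain ⟨ρ, hρ, hρV⟩ := Metric.isOpen_iff.1 hVo p hpV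
  set D := Metric.ball p ρ with hDdef
  have hDo : IsOpen D := Metric.isOpen_ball
  have hpD : p ∈ D := Metric.mem_ball_self hρ
  have hDB : D ⊆ B := hρV.trans hVB
  have hDW : D ⊆ W := hDB.trans hRW
  have hcD : ∀ i, ContDiffOn ℝ (⊤ : ℕ∞) (ω i) D := fun i => (hc i).mono hDB
  have hy₁D := hy₁.mono hDB
  have hy₂D := hy₂.mono hDB
  have hgs : ∀ n, ContDiffOn ℝ (⊤ : ℕ∞) (fun q => iteratedDeriv n h (y₁ q)) D := fun n =>
    (contDiffOn_iteratedDeriv hJ hh n).comp hy₁D fun q hq => hyJ q (hρV hq)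
  have hgd : ∀ n, ∀ q ∈ D, HasFDerivAt (fun q => iteratedDeriv n h (y₁ q))
      (iteratedDeriv (n + 1) h (y₁ q) • ω 6 q) q := fun n q hq =>
    (hasDerivAt_iteratedDeriv hJ hh n (hyJ q (hρV hq))).comp_hasFDerivAt q (hy₁d q (hDB hq))
  -- Here h''' = 2u enters: differentiating the coefficient h''/2 of ω² produces exactly the term
  -- cancelling u ω² ∧ ω⁷ in dω³. The h'' and h' terms cancel against those from h'ω⁵ and hω⁸.
  obtain ⟨z₂₂, hz₂₂, hz₂₂d⟩ := exists_smooth_primitive_of_closed (convex_ball p ρ) hDo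
    (α := fun q => -((1 / 2 * iteratedDeriv 2 h (y₁ q)) • ω 1 q) - ω 2 q + (2 * y₂ q) • ω 3 q
      + iteratedDeriv 1 h (y₁ q) • ω 4 q - (y₂ q * y₂ q + iteratedDeriv 0 h (y₁ q)) • ω 7 q)
    ((((((contDiffOn_const.mul (hgs 2)).smul (hcD 1)).neg.sub (hcD 2)).add
      ((contDiffOn_const.mul hy₂D).smul (hcD 3))).add ((hgs 1).smul (hcD 4))).sub
      (((hy₂D.mul hy₂D).add (hgs 0)).smul (hcD 7)))
    fun q hq => ⟨_, (((((((hgd 2 q hq).const_mul (1 / 2)).smul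
      (N.hasFDerivAt (hDW hq) 1)).neg.sub (N.hasFDerivAt (hDW hq) 2)).add
      (((hy₂d q (hDB hq)).const_mul 2).smul (N.hasFDerivAt (hDW hq) 3))).add
      ((hgd 1 q hq).smul (N.hasFDerivAt (hDW hq) 4))).sub
      ((((hy₂d q (hDB hq)).mul (hy₂d q (hDB hq))).add (hgd 0 q hq)).smul
        (N.hasFDerivAt (hDW hq) 7))), fun v w => by
      simp
      linear_combination -(1 / 2 * iteratedDeriv 2 h (y₁ q)) * N.d2_apply (hDW hq) v w
        - N.d3_apply (hDW hq) v w + 2 * y₂ q * N.d4_apply (hDW hq) v w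
        + deriv h (y₁ q) * N.d5_apply (hDW hq) v w
        - (y₂ q * y₂ q + h (y₁ q)) * N.d8_apply (hDW hq) v w
        - (ω 1 q v * ω 6 q w - ω 1 q w * ω 6 q v) * huV q (hρV hq)⟩
  let f : E8 → E8 := fun q => ![t q, x₁ q, x₂ q, y₁ q, y₂ q, z₁₁ q, z₁₂ q, z₂₂ q]
  have hf : ContDiffOn ℝ (⊤ : ℕ∞) f D := contDiffOn_pi.2 (fin8_forall (ht.mono hDB)
    (hx₁.mono hDB) (hx₂.mono hDB) hy₁D hy₂D (hz₁₁.mono hDB) (hz₁₂.mono hDB) hz₂₂)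
  have hfd : ∀ q ∈ D, HasFDerivAt f (fderiv ℝ f q) q := fun q hq =>
    ((hf.contDiffAt (hDo.mem_nhds hq)).differentiableAt (by simp)).hasFDerivAt
  have hco : ∀ q ∈ D, ∀ (k : Fin 8) (β : E8 →L[ℝ] ℝ), HasFDerivAt (fun q => f q k) β q →
      ∀ v, fderiv ℝ f q v k = β v := fun q hq k β hβ v =>
    DFunLike.congr_fun ((hasFDerivAt_pi'.1 (hfd q hq) k).unique hβ) v
  have c0 := fun q (hq : q ∈ D) => hco q hq 0 _ (htd q (hDB hq))
  have c1 := fun q (hq : q ∈ D) => hco q hq 1 _ (hx₁d q (hDB hq))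
  have c2 := fun q (hq : q ∈ D) => hco q hq 2 _ (hx₂d q (hDB hq))
  have c3 := fun q (hq : q ∈ D) => hco q hq 3 _ (hy₁d q (hDB hq))
  have c4 := fun q (hq : q ∈ D) => hco q hq 4 _ (hy₂d q (hDB hq))
  have c5 := fun q (hq : q ∈ D) => hco q hq 5 _ (hz₁₁d q (hDB hq))
  have c6 := fun q (hq : q ∈ D) => hco q hq 6 _ (hz₁₂d q (hDB hq))
  have c7 := fun q (hq : q ∈ D) => hco q hq 7 _ (hz₂₂d q hq)
  -- The relations between the differentials and the ω^i are triangular, so a vector killed by all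
  -- eight differentials is killed by the coframe.
  obtain ⟨e, he⟩ := exists_linearEquiv_of_coframe N.isCoframe hp (A := fderiv ℝ f p) (by
    intro v hv
    have k0 := c0 p hpD v
    have k1 := c1 p hpD v
    have k2 := c2 p hpD v
    have k3 := c3 p hpD v
    have k4 := c4 p hpD v
    have k5 := c5 p hpD v
    have k6 := c6 p hpD v
    have k7 := c7 p hpD v
    simp only [hv, Pi.zero_apply, add_apply, sub_apply, neg_apply, smul_apply, smul_eq_mul]
      at k0 k1 k2 k3 k4 k5 k6 k7
    have l7 : ω 7 p v = 0 := by linarith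
    simp only [l7, mul_zero, sub_zero] at k1 k2 k5 k6 k7
    simp only [← k1, ← k2, mul_zero, add_zero] at k5 k6 k7
    have l1 : ω 1 p v = 0 := by linarith
    have l0 : ω 0 p v = 0 := by linarith
    rw [l1] at k7
    have l2 : ω 2 p v = 0 := by linarith
    exact fin8_forall l0 l1 l2 k2.symm k1.symm k4.symm k3.symm l7)
  obtain ⟨φ, hφf, hpφ, hφD, hφs⟩ := exists_smooth_chart hDo hf hpD (e := e)
    (by rw [he]; exact hfd p hpD)
  refine ⟨h, J, hJ, hh, φ, ⟨?_, ?_, ?_, hφs, ?_⟩, hpφ, hφD.trans hDW, fun x hx => hx.2, ?_⟩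
  · exact (hφD.trans hDW).trans H.subset
  · intro a ha
    have ha' := φ.map_target ha
    have := hyJ _ (hρV (hφD ha'))
    rw [← φ.right_inv ha, hφf]
    exact this
  · rw [hφf]
    exact hf.mono hφD
  · refine (H.related.mono (hφD.trans hDW)).trans ?_
    rw [hφf]
    refine MongeRelatedOn.mono (mongeRelatedOn_of_eqs (a := y₁) (b := y₂)
      (c := fun q => -(1 / 2 * iteratedDeriv 2 h (y₁ q)))
      (d := fun q => iteratedDeriv 1 h (y₁ q)) hy₁D hy₂D
      (contDiffOn_const.mul (hgs 2)).neg (hgs 1) fun q hq => ?_) hφD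
    refine ⟨?_, ?_, ?_, ?_, ?_, ?_, ?_, ?_⟩ <;> ext v <;>
      simp [OneForm.pullback, MongeSystem.toStructure, MongeSystem.coframe, MongeSystem.ofFun,
        dcoord, c0 q hq, c1 q hq, c2 q hq, c3 q hq, c4 q hq, c5 q hq, c6 q hq, c7 q hq, f] <;>
      ring
  · intro q hq
    rw [hφf]
    exact (hinv q (hρV (hφD hq))).2

end MongeGeom

open MongeGeom
theorem mainTheorem11 :
    (∀ (S : MongeStructure) (W : Set E8) (ω : Forms8) (u : E8 → ℝ),
      S.IsAdapted W ω u → (∀ p ∈ W, I₁ ω u p ≠ 0) → (∀ p ∈ W, I₂ ω u p = 0) →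
      ∀ p ∈ W, ∃ (h : ℝ → ℝ) (J : Set ℝ) (hJ : IsOpen J) (hh : ContDiffOn ℝ (⊤ : ℕ∞) h J)
        (φ : OpenPartialHomeomorph E8 E8),
        IsLocalEquivalence S (MongeSystem.ofFun h J hJ hh).toStructure φ ∧
        p ∈ φ.source ∧ φ.source ⊆ W ∧
        (∀ x ∈ J, iteratedDeriv 3 h x ≠ 0 ∧ discr h x ≠ 0) ∧
        ∀ q ∈ φ.source,
          I₁ ω u q = 1 / 4 * discr h (φ q 3) ∧ S₄ ω u q = s4Formula h (φ q 3)) ∧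
    (∀ (h : ℝ → ℝ) (J : Set ℝ) (hJ : IsOpen J) (hh : ContDiffOn ℝ (⊤ : ℕ∞) h J),
      (∀ x ∈ J, iteratedDeriv 3 h x ≠ 0) →
      ∃ (ω : Forms8) (u : E8 → ℝ),
        (MongeSystem.ofFun h J hJ hh).toStructure.IsAdapted
          (MongeSystem.ofFun h J hJ hh).space ω u ∧
        ∀ p ∈ (MongeSystem.ofFun h J hJ hh).space,
          u p = 1 / 2 * iteratedDeriv 3 h (p 3) ∧
          I₂ ω u p = 0 ∧
          I₁ ω u p = 1 / 4 * discr h (p 3) ∧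
          (I₁ ω u p ≠ 0 → S₄ ω u p = s4Formula h (p 3))) := by
  refine ⟨fun S W ω u H hI₁ hI₂ p hp => exists_isLocalEquivalence_ofFun H hI₁ hI₂ hp,
    fun h J hJ hh h3 => ⟨modelCoframe h, fun p => 1 / 2 * iteratedDeriv 3 h (p 3),
      ⟨subset_rfl, mongeRelatedOn_modelCoframe hJ hh, satisfiesEDS_modelCoframe hJ hh h3⟩,
      fun p hp => ?_⟩⟩
  have N := satisfiesEDS_modelCoframe hJ hh h3
  obtain ⟨e2, e1, e4⟩ := invariants_of_comp (y := fun q : E8 => q 3) N.isOpen N.isCoframe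
    (fun q _ => hasFDerivAt_apply 3 q) hJ hh (fun q hq => hq) (fun q _ => rfl) hp
  exact ⟨rfl, e2, e1, fun _ => e4⟩
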